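/- Let $\mathbb{K}$ be an algebraically closed field of characteristic $0$ and let $\mathfrak{g}$ be a root-reductive Lie algebra over $\mathbb{K}$: $\mathfrak{g}$ is locally finite and is the union of a nested sequence $\mathfrak{g}_1\subseteq\mathfrak{g}_2\subseteq\cdots$ of finite-dimensional reductive subalgebras admitting nested Cartan subalgebras $\mathfrak{k}_n\subseteq\mathfrak{g}_n$ such that, for every $n$, $\mathfrak{g}_n\cap\mathfrak{k}_{n+1}$ is a Cartan subalgebra of $\mathfrak{g}_n$ and every $(\mathfrak{g}_n\cap\mathfrak{k}_{n+1})$-root space of $\mathfrak{g}_n$ is a $\mathfrak{k}_{n+1}$-root space of $\mathfrak{g}_{n+1}$. Let $\mathfrak{h}\subseteq\mathfrak{g}$ be a splitting maximal toral subalgebra: $\mathfrak{g}$ is the union of some nested sequence of finite-dimensional reductive subalgebras $\mathfrak{g}'_n$ such that each $\mathfrak{h}\cap\mathfrak{g}'_n$ is a maximal toral subalgebra of $\mathfrak{g}'_n$, and $\mathfrak{g}=\bigoplus_{\alpha\in\mathfrak{h}^*}\mathfrak{g}^\alpha$ with $\mathfrak{g}^0=\mathfrak{h}$, where $\mathfrak{g}^\alpha=\{x\in\mathfrak{g}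 : [h,x]=\alpha(h)x \text{ for all } h\in\mathfrak{h}\}$; the roots are the $\alpha\neq 0$ with $\mathfrak{g}^\alpha\neq 0$. Let $\mathfrak{b}\supseteq\mathfrak{h}$ be a Dynkin Borel subalgebra: a maximal locally solvable subalgebra of $\mathfrak{g}$ that is generated by $\mathfrak{h}$ and the root spaces $\mathfrak{g}^\alpha$ of the simple roots $\alpha$, i.e. of the positive roots (roots with $\mathfrak{g}^\alpha\subseteq\mathfrak{b}$) that are not a sum of two or more positive roots. Put $\mathfrak{n}=[\mathfrak{b},\mathfrak{b}]$. Let $\bar{\mathcal{O}}$ be the full subcategory of the category of $\mathfrak{g}$-modules whose objects are the modules $M$ such that $M=\bigoplus_{\lambda\in\mathfrak{h}^*}M^\lambda$, where $M^\lambda=\{v\in M : hv=\lambda(h)v\text{ for all }h\in\mathfrak{h}\}$, every $M^\lambda$ is finite-dimensional, and $\mathrm{U}(\mathfrak{n})v$ is finite-dimensional for every $v\in M$. An object is indecomposable if it is nonzero and is not the direct sum of two nonzero submodules. Then, for every object $M$ of $\bar{\mathcal{O}}$: 1. $M$ is a direct sum of (possibly infinitely many, or no) submodules that are indecomposable objects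 of $\bar{\mathcal{O}}$. 2. This decomposition is unique up to isomorphism: if $M=\bigoplus_{j\in J}M_j=\bigoplus_{j'\in J'}M'_{j'}$, where all $M_j$ and $M'_{j'}$ are submodules of $M$ that are indecomposable objects of $\bar{\mathcal{O}}$, then there is a bijection $\psi:J\to J'$ such that $M_j\cong M'_{\psi(j)}$ for every $j\in J$. 3. If $M$ is indecomposable, then the endomorphism ring $\operatorname{End}_{\bar{\mathcal{O}}}(M)$ is a local ring. -/

import Mathlib

namespace ExtO

section LieAlgebras

/-- Every finite subset generates a finite-dimensional subalgebra. -/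
def IsLocallyFinite (K L : Type*) [Field K] [LieRing L] [LieAlgebra K L] : Prop :=
  ∀ s : Finset L, FiniteDimensional K (LieSubalgebra.lieSpan K L (s : Set L))

/-- Locally finite, and every finite-dimensional subalgebra is solvable. -/
def IsLocallySolvable (K L : Type*) [Field K] [LieRing L] [LieAlgebra K L] : Prop :=
  IsLocallyFinite K L ∧
    ∀ s : LieSubalgebra K L, FiniteDimensional K s → LieAlgebra.IsSolvable s

/-- A finite-dimensional Lie algebra is reductive if its radical equals its center.
(Only used for finite-dimensional Lie algebras.) -/
def IsReductive (K L : Type*) [Field K] [LieRing L] [LieAlgebra K L] : Prop :=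
  LieAlgebra.radical K L = LieAlgebra.center K L

/-- A subalgebra consisting of semisimple (that is, `ad`-semisimple) elements. -/
def IsToral {K L : Type*} [Field K] [LieRing L] [LieAlgebra K L]
    (t : LieSubalgebra K L) : Prop :=
  ∀ x ∈ t, (LieAlgebra.ad K L x).IsSemisimple

variable {K : Type*} {𝔤 : Type*} [Field K] [LieRing 𝔤] [LieAlgebra K 𝔤]

/-- For subalgebras `𝔠` and `𝔩` of `𝔤` and `α ∈ 𝔠^*`, the space
`𝔩^α = {x ∈ 𝔩 | [h, x] = α(h) x for all h ∈ 𝔠}`. -/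
def rootSpaceOf (𝔩 𝔠 : LieSubalgebra K 𝔤) (α : Module.Dual K 𝔠) : Submodule K 𝔤 :=
  𝔩.toSubmodule ⊓ (LieModule.weightSpace 𝔤 (α : 𝔠 → K)).toSubmodule

/-- `α` is a root of `𝔩` with respect to `𝔠`: it is nonzero and `𝔩^α ≠ 0`. -/
def IsRootOf (𝔩 𝔠 : LieSubalgebra K 𝔤) (α : Module.Dual K 𝔠) : Prop :=
  α ≠ 0 ∧ rootSpaceOf 𝔩 𝔠 α ≠ ⊥

/-- `𝔠 ⊆ 𝔩` and `𝔠`, regarded as a subalgebra of the Lie algebra `𝔩`, is a Cartan subalgebra. -/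
def IsCartanIn (𝔩 𝔠 : LieSubalgebra K 𝔤) : Prop :=
  𝔠 ≤ 𝔩 ∧ (𝔠.comap 𝔩.incl).IsCartanSubalgebra

/-- The inclusion `𝔩 ⊆ 𝔪` is a root inclusion with respect to the Cartan subalgebra `𝔠` of `𝔪`. -/
def IsRootInclusion (𝔩 𝔪 𝔠 : LieSubalgebra K 𝔤) : Prop :=
  𝔩 ≤ 𝔪 ∧ IsCartanIn 𝔪 𝔠 ∧ IsCartanIn 𝔩 (𝔩 ⊓ 𝔠) ∧
    ∀ α : Module.Dual K (𝔩 ⊓ 𝔠 : LieSubalgebra K 𝔤), IsRootOf 𝔩 (𝔩 ⊓ 𝔠) α →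
      ∃ β : Module.Dual K 𝔠, IsRootOf 𝔪 𝔠 β ∧ rootSpaceOf 𝔩 (𝔩 ⊓ 𝔠) α = rootSpaceOf 𝔪 𝔠 β

/-- `𝔤` is the union of the nested sequence `G` of finite-dimensional reductive subalgebras. -/
structure IsReductiveExhaustion (G : ℕ → LieSubalgebra K 𝔤) : Prop where
  nested : Monotone G
  finiteDimensional : ∀ n, FiniteDimensional K (G n)
  reductive : ∀ n, IsReductive K (G n)
  union : ∀ x : 𝔤, ∃ n, x ∈ G n

variable (K 𝔤) in
/-- Root-reductive Lie algebras. -/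
def IsRootReductive : Prop :=
  IsLocallyFinite K 𝔤 ∧
    ∃ G k : ℕ → LieSubalgebra K 𝔤, IsReductiveExhaustion G ∧ Monotone k ∧
      (∀ n, IsCartanIn (G n) (k n)) ∧
      ∀ n, IsRootInclusion (G n) (G (n + 1)) (k (n + 1))

/-- Splitting maximal toral subalgebras: for some exhaustion of `𝔤` by finite-dimensional reductive
subalgebras `𝔤ₙ`, each `𝔥 ∩ 𝔤ₙ` is a maximal toral subalgebra of `𝔤ₙ`, and
`𝔤 = ⨁_{α ∈ 𝔥^*} 𝔤^α` with `𝔤^0 = 𝔥`. -/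
structure IsSplittingMaximalToral (𝔥 : LieSubalgebra K 𝔤) : Prop where
  exhaustion : ∃ G : ℕ → LieSubalgebra K 𝔤, IsReductiveExhaustion G ∧
    ∀ n, Maximal IsToral (𝔥.comap (G n).incl)
  independent : iSupIndep fun α : Module.Dual K 𝔥 => rootSpaceOf ⊤ 𝔥 α
  span : ⨆ α : Module.Dual K 𝔥, rootSpaceOf ⊤ 𝔥 α = ⊤
  zero : rootSpaceOf ⊤ 𝔥 0 = 𝔥.toSubmodule

/-- Splitting Borel subalgebras: maximal locally solvable subalgebras that contain a splitting
maximal toral subalgebra. -/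
structure IsSplittingBorel (𝔟 : LieSubalgebra K 𝔤) : Prop where
  maximal : Maximal (fun 𝔰 : LieSubalgebra K 𝔤 => IsLocallySolvable K 𝔰) 𝔟
  splitting : ∃ 𝔥 : LieSubalgebra K 𝔤, IsSplittingMaximalToral 𝔥 ∧ 𝔥 ≤ 𝔟

/-- `𝔟`-positive roots: the roots `α` of `𝔤` with `𝔤^α ⊆ 𝔟`. -/
def IsPositiveRoot (𝔥 𝔟 : LieSubalgebra K 𝔤) (α : Module.Dual K 𝔥) : Prop :=
  IsRootOf ⊤ 𝔥 α ∧ rootSpaceOf ⊤ 𝔥 α ≤ 𝔟.toSubmodule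

/-- Simple roots: positive roots that are not a sum of two or more positive roots. -/
def IsSimpleRoot (𝔥 𝔟 : LieSubalgebra K 𝔤) (α : Module.Dual K 𝔥) : Prop :=
  IsPositiveRoot 𝔥 𝔟 α ∧
    ∀ s : Multiset (Module.Dual K 𝔥), (∀ β ∈ s, IsPositiveRoot 𝔥 𝔟 β) → 2 ≤ s.card → s.sum ≠ α

/-- `𝔟` is a Dynkin Borel subalgebra of `𝔤` containing the splitting maximal toral
subalgebra `𝔥`: it is a splitting Borel subalgebra containing `𝔥`, and it is generated by `𝔥` and
the simple root spaces. -/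
structure IsDynkinBorel (𝔥 𝔟 : LieSubalgebra K 𝔤) : Prop where
  toral : IsSplittingMaximalToral 𝔥
  borel : IsSplittingBorel 𝔟
  le : 𝔥 ≤ 𝔟
  generated : LieSubalgebra.lieSpan K 𝔤
    ((𝔥 : Set 𝔤) ∪ ⋃ (α : Module.Dual K 𝔥) (_ : IsSimpleRoot 𝔥 𝔟 α), (rootSpaceOf ⊤ 𝔥 α : Set 𝔤))
      = 𝔟

/-- The subalgebra `𝔫 = [𝔟, 𝔟]` of `𝔤`. -/
def derivedPart (𝔟 : LieSubalgebra K 𝔤) : LieSubalgebra K 𝔤 :=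
  (LieIdeal.toLieSubalgebra K 𝔟 ⁅(⊤ : LieIdeal K 𝔟), (⊤ : LieIdeal K 𝔟)⁆).map 𝔟.incl

end LieAlgebras

section Modules

variable {K : Type*} {𝔤 : Type*} [Field K] [LieRing 𝔤] [LieAlgebra K 𝔤]

/-- The `𝔥`-weight space `M^μ = {v ∈ M | h v = μ(h) v for all h ∈ 𝔥}`. -/
def weightSpaceOf (𝔥 : LieSubalgebra K 𝔤) (M : Type*) [AddCommGroup M] [Module K M]
    [LieRingModule 𝔤 M] [LieModule K 𝔤 M] (μ : Module.Dual K 𝔥) : Submodule K M :=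
  (LieModule.weightSpace M (μ : 𝔥 → K)).toSubmodule

/-- Membership of a `𝔤`-module `M` in the extended category O of `(𝔤, 𝔥, 𝔟)`. -/
structure InExtendedO (𝔥 𝔟 : LieSubalgebra K 𝔤) (M : Type*) [AddCommGroup M] [Module K M]
    [LieRingModule 𝔤 M] [LieModule K 𝔤 M] : Prop where
  independent : iSupIndep fun μ : Module.Dual K 𝔥 => weightSpaceOf 𝔥 M μ
  span : ⨆ μ : Module.Dual K 𝔥, weightSpaceOf 𝔥 M μ = ⊤
  finiteDimensional : ∀ μ : Module.Dual K 𝔥, FiniteDimensional K (weightSpaceOf 𝔥 M μ)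
  /-- The `𝔫`-submodule generated by `v`, which is `U(𝔫) v`, is finite-dimensional. -/
  locallyFinite : ∀ v : M,
    FiniteDimensional K (LieSubmodule.lieSpan K (derivedPart 𝔟) ({v} : Set M))

variable (K 𝔤) in
/-- `M` is nonzero and is not the direct sum of two nonzero `𝔤`-submodules. -/
structure IsIndecomposableModule (M : Type*) [AddCommGroup M] [Module K M]
    [LieRingModule 𝔤 M] [LieModule K 𝔤 M] : Prop where
  nonzero : Nontrivial M
  indecomposable : ∀ N P : LieSubmodule K 𝔤 M, IsCompl N P → N = ⊥ ∨ P = ⊥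

/-- `M = ⨁ j, D j` is an (internal) direct sum decomposition of `M` into `𝔤`-submodules that are
indecomposable objects of the extended category O. -/
structure IsIndecomposableDecomposition (𝔥 𝔟 : LieSubalgebra K 𝔤) {M : Type*} [AddCommGroup M]
    [Module K M] [LieRingModule 𝔤 M] [LieModule K 𝔤 M] {J : Type*}
    (D : J → LieSubmodule K 𝔤 M) : Prop where
  independent : iSupIndep fun j => (D j).toSubmodule
  span : ⨆ j, (D j).toSubmodule = ⊤
  mem : ∀ j, InExtendedO 𝔥 𝔟 (D j)
  indecomposable : ∀ j, IsIndecomposableModule K 𝔤 (D j)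

variable (K 𝔤) in
/-- The ring of `𝔤`-module endomorphisms of `M`: the `K`-linear endomorphisms of `M` that commute
with the action of `𝔤`. -/
abbrev moduleEnd (M : Type*) [AddCommGroup M] [Module K M]
    [LieRingModule 𝔤 M] [LieModule K 𝔤 M] : Subalgebra K (Module.End K M) :=
  Subalgebra.centralizer K (Set.range (LieModule.toEnd K 𝔤 M))

end Modules

end ExtO

universe u v w w₁ w₂

namespace ExtO

/-! An endomorphism of `M` preserves the finite-dimensional weight spaces, and these span `M`, so
linear algebra can be done weight space by weight space. In particular `M` is the direct sum of the
generalized eigenspaces of an endomorphism, which are submodules. If `M` is indecomposable, only one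
eigenvalue c can occur (`exists_genEigen_eq_top`): every endomorphism is c plus a locally nilpotent
map, and it is bijective when c ≠ 0. Hence the endomorphism ring is local.

Existence: by Zorn's lemma, choose a maximal set of commuting idempotent endomorphisms. Its joint
eigenspaces decompose `M`, and a nonzero one cannot split further, since the projection onto a
summand would be a new commuting idempotent (`indecomposable_jointEigenspace`).

Uniqueness: fix an indecomposable `X` and a weight μ with X^μ ≠ 0. Divided by dim X^μ, the trace on
X^μ is the residue homomorphism of the endomorphism ring to K (`weightTrace_comp`). If X → D j → X
has nonzero trace, it is bijective, so D j ≅ X; the trace of X → M → X is thus a finite sum over the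
copies of `X` in either decomposition. Taking traces of the maps between copies of `X` in the two
decompositions gives matrices whose product is a nonzero scalar matrix, and comparing ranks shows
that the multiplicities agree. -/

theorem isCompl_iSup_ne {α ι : Type*} [CompleteLattice α] {t : ι → α} (h : iSupIndep t)
    (htop : ⨆ i, t i = ⊤) (j : ι) : IsCompl (t j) (⨆ (i) (_ : i ≠ j), t i) := by
  refine ⟨h j, ?_⟩
  rw [codisjoint_iff, eq_top_iff, ← htop]
  refine iSup_le fun i => ?_
  by_cases hij : i = j
  · exact hij ▸ le_sup_left
  · exact le_sup_of_le_right (le_iSup₂_of_le i hij le_rfl)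

/-! ### Endomorphisms preserving finite-dimensional subspaces that span; projections. -/

section LinearAlgebra

variable {K V ι : Type*} [Field K] [AddCommGroup V] [Module K V]

/-- Commuting endomorphisms that preserve finite-dimensional spaces spanning `V` have
simultaneous generalized eigenspaces spanning `V`. -/
theorem iSup_iInf_maxGenEigenspace_eq_top [IsAlgClosed K] {κ : Type*} {W : κ → Submodule K V}
    (hW : ⨆ k, W k = ⊤) (hfin : ∀ k, FiniteDimensional K (W k)) (f : ι → Module.End K V)
    (hf : ∀ i k, ∀ v ∈ W k, f i v ∈ W k) (hcomm : ∀ i j, Commute (f i) (f j)) :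
    ⨆ χ : ι → K, ⨅ i, (f i).maxGenEigenspace (χ i) = ⊤ := by
  rw [eq_top_iff, ← hW]
  refine iSup_le fun k => ?_
  have := hfin k
  have key : ⨆ χ : ι → K, ⨅ i,
      Module.End.maxGenEigenspace ((f i).restrict (hf i k)) (χ i) = ⊤ := by
    refine Module.End.iSup_iInf_maxGenEigenspace_eq_top_of_iSup_maxGenEigenspace_eq_top_of_commute
      _ (fun i j _ => ?_) fun i => Module.End.iSup_maxGenEigenspace_eq_top _
    refine LinearMap.ext fun v => Subtype.ext ?_
    exact LinearMap.congr_fun (hcomm i j) (v : V)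
  calc W k = (⊤ : Submodule K (W k)).map (W k).subtype := by simp
    _ = ⨆ χ : ι → K, W k ⊓ ⨅ i, (f i).maxGenEigenspace (χ i) := by
        rw [← key, Submodule.map_iSup]
        refine iSup_congr fun χ => ?_
        rw [Submodule.inf_iInf_maxGenEigenspace_of_forall_mapsTo f (W k) fun i => hf i k]
    _ ≤ _ := iSup_mono fun χ => inf_le_right

theorem iSup_maxGenEigenspace_eq_top [IsAlgClosed K] {W : ι → Submodule K V}
    (hW : ⨆ k, W k = ⊤) (hfin : ∀ k, FiniteDimensional K (W k)) (f : Module.End K V)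
    (hf : ∀ k, ∀ v ∈ W k, f v ∈ W k) : ⨆ c : K, f.maxGenEigenspace c = ⊤ := by
  rw [eq_top_iff,
    ← iSup_iInf_maxGenEigenspace_eq_top hW hfin (fun _ : Unit => f) (fun _ => hf)
      fun _ _ => Commute.refl _]
  refine iSup_le fun χ => ?_
  rw [iInf_unique]
  exact le_iSup (fun c => f.maxGenEigenspace c) (χ default)

/-- The restriction to each finite-dimensional `W k` is injective, hence surjective, so the range
contains every `W k`. -/
theorem surjective_of_injective_of_iSup_eq_top {W : ι → Submodule K V}
    (hW : ⨆ k, W k = ⊤) (hfin : ∀ k, FiniteDimensional K (W k)) {f : Module.End K V}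
    (hf : ∀ k, ∀ v ∈ W k, f v ∈ W k) (hinj : Function.Injective f) : Function.Surjective f := by
  rw [← LinearMap.range_eq_top, eq_top_iff, ← hW]
  refine iSup_le fun k v hv => ?_
  have := hfin k
  have hr : Function.Injective (f.restrict (hf k)) := fun x y hxy =>
    Subtype.ext (hinj (congrArg Subtype.val hxy))
  obtain ⟨w, hw⟩ := LinearMap.injective_iff_surjective.mp hr ⟨v, hv⟩
  exact ⟨w, congrArg Subtype.val hw⟩

theorem iSupIndep_of_map_le {V' : Type*} [AddCommGroup V'] [Module K V'] {f : V →ₗ[K] V'}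
    (hf : Function.Injective f) {A : ι → Submodule K V} {B : ι → Submodule K V'}
    (hB : iSupIndep B) (hAB : ∀ i, (A i).map f ≤ B i) : iSupIndep A := by
  intro i
  have h := (hB i).mono (hAB i) (iSup₂_mono fun j _ => hAB j)
  rw [Submodule.disjoint_def] at h ⊢
  intro v hv hv'
  have hm := Submodule.mem_map_of_mem (f := f) hv'
  simp only [Submodule.map_iSup] at hm
  exact hf ((h (f v) ⟨v, hv, rfl⟩ hm).trans (map_zero f).symm)

theorem projection_commute {p q : Submodule K V} (h : IsCompl p q) {f : Module.End K V}
    (hp : ∀ v ∈ p, f v ∈ p) (hq : ∀ v ∈ q, f v ∈ q) (v : V) :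
    p.projection q h (f v) = f (p.projection q h v) := by
  conv_lhs => rw [← Submodule.projection_add_projection_eq_self h v]
  rw [map_add, map_add, Submodule.projection_apply_of_mem_left h (hp _ (by simp)),
    Submodule.projection_apply_of_mem_right h (hq _ (by simp)), add_zero]

end LinearAlgebra

/-! ### Direct summands, generalized eigenspaces and local endomorphism rings. -/

section Modules

variable {K 𝔤 : Type*} [Field K] [LieRing 𝔤] [LieAlgebra K 𝔤] {𝔥 𝔟 : LieSubalgebra K 𝔤}
  {X : Type*} [AddCommGroup X] [Module K X] [LieRingModule 𝔤 X] [LieModule K 𝔤 X]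
  {Y : Type*} [AddCommGroup Y] [Module K Y] [LieRingModule 𝔤 Y] [LieModule K 𝔤 Y]

theorem mem_weightSpaceOf {μ : Module.Dual K 𝔥} {v : X} :
    v ∈ weightSpaceOf 𝔥 X μ ↔ ∀ h : 𝔥, ⁅(h : 𝔤), v⁆ = μ h • v :=
  LieModule.mem_weightSpace (μ : 𝔥 → K) v

theorem map_mem_weightSpaceOf (f : X →ₗ⁅K,𝔤⁆ Y) {μ : Module.Dual K 𝔥} {v : X}
    (hv : v ∈ weightSpaceOf 𝔥 X μ) : f v ∈ weightSpaceOf 𝔥 Y μ := by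
  rw [mem_weightSpaceOf] at hv ⊢
  intro h
  rw [← LieModuleHom.map_lie, hv, map_smul]

/-- A bijective homomorphism of `𝔤`-modules as an isomorphism. -/
noncomputable def equivOfBijective (f : X →ₗ⁅K,𝔤⁆ Y) (hf : Function.Bijective f) :
    X ≃ₗ⁅K,𝔤⁆ Y :=
  { LinearEquiv.ofBijective (f : X →ₗ[K] Y) hf with
    map_lie' := fun {x m} => f.map_lie x m }

/-- The projection of `X` onto a direct summand. -/
noncomputable def projOnto {N P : LieSubmodule K 𝔤 X} (h : IsCompl N P) : X →ₗ⁅K,𝔤⁆ N :=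
  { Submodule.projectionOnto N.toSubmodule P.toSubmodule
      (LieSubmodule.isCompl_toSubmodule.mpr h) with
    map_lie' := fun {x m} => Subtype.ext <| by
      exact projection_commute (LieSubmodule.isCompl_toSubmodule.mpr h)
        (f := LieModule.toEnd K 𝔤 X x) (fun v hv => N.lie_mem hv) (fun v hv => P.lie_mem hv) m }

theorem projOnto_of_mem_left {N P : LieSubmodule K 𝔤 X} (h : IsCompl N P) {v : X} (hv : v ∈ N) :
    projOnto h v = ⟨v, hv⟩ :=
  Submodule.projectionOnto_apply_of_mem_left (LieSubmodule.isCompl_toSubmodule.mpr h) hv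

theorem projOnto_of_mem_right {N P : LieSubmodule K 𝔤 X} (h : IsCompl N P) {v : X} (hv : v ∈ P) :
    projOnto h v = 0 :=
  Submodule.projectionOnto_apply_of_mem_right (LieSubmodule.isCompl_toSubmodule.mpr h) hv

/-- The extended category O is closed under direct summands. -/
theorem InExtendedO.of_isCompl (hX : InExtendedO 𝔥 𝔟 X) {N P : LieSubmodule K 𝔤 X}
    (h : IsCompl N P) : InExtendedO 𝔥 𝔟 N := by
  have hle (μ : Module.Dual K 𝔥) :
      (weightSpaceOf 𝔥 N μ).map N.toSubmodule.subtype ≤ weightSpaceOf 𝔥 X μ := by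
    rintro _ ⟨v, hv, rfl⟩
    exact map_mem_weightSpaceOf N.incl hv
  refine ⟨?_, ?_, fun μ => ?_, fun v => ?_⟩
  · exact iSupIndep_of_map_le N.toSubmodule.injective_subtype hX.independent hle
  · rw [eq_top_iff]
    intro v _
    have hv : (v : X) ∈ ⨆ μ : Module.Dual K 𝔥, weightSpaceOf 𝔥 X μ := by
      rw [hX.span]; trivial
    have := Submodule.mem_map_of_mem (f := (projOnto h : X →ₗ[K] N)) hv
    rw [Submodule.map_iSup] at this
    have h2 : (projOnto h : X →ₗ[K] N) v = v := projOnto_of_mem_left h v.2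
    rw [h2] at this
    have hm (μ : Module.Dual K 𝔥) : (weightSpaceOf 𝔥 X μ).map (projOnto h : X →ₗ[K] N) ≤
        weightSpaceOf 𝔥 N μ := by
      rintro _ ⟨w, hw, rfl⟩
      exact map_mem_weightSpaceOf (projOnto h) hw
    exact iSup_mono hm this
  · have := hX.finiteDimensional μ
    refine Module.Finite.of_injective
      (N.toSubmodule.subtype.restrict (p := weightSpaceOf 𝔥 N μ) (q := weightSpaceOf 𝔥 X μ)
        fun v hv => hle μ ⟨v, hv, rfl⟩) fun x y hxy => Subtype.ext (Subtype.ext ?_)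
    exact congrArg (fun z : weightSpaceOf 𝔥 X μ => (z : X)) hxy
  · have := hX.locallyFinite v
    -- Viewed as 𝔫-linear, the inclusion embeds U(𝔫)v computed in `N` into U(𝔫)v computed in `X`.
    let i : N →ₗ⁅K,derivedPart 𝔟⁆ X :=
      { N.toSubmodule.subtype with map_lie' := fun {x m} => rfl }
    have hs : LieSubmodule.lieSpan K (derivedPart 𝔟) ({v} : Set N) ≤
        (LieSubmodule.lieSpan K (derivedPart 𝔟) ({(v : X)} : Set X)).comap i := by
      rw [LieSubmodule.lieSpan_le, Set.singleton_subset_iff]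
      exact LieSubmodule.subset_lieSpan rfl
    exact Module.Finite.of_injective
      (N.toSubmodule.subtype.restrict
        (p := (LieSubmodule.lieSpan K (derivedPart 𝔟) ({v} : Set N)).toSubmodule)
        (q := (LieSubmodule.lieSpan K (derivedPart 𝔟) ({(v : X)} : Set X)).toSubmodule)
        fun w hw => hs hw) fun x y hxy => Subtype.ext (Subtype.ext
          (congrArg (fun z : (LieSubmodule.lieSpan K (derivedPart 𝔟)
            ({(v : X)} : Set X)).toSubmodule => (z : X)) hxy))

/-- A generalized eigenspace of an endomorphism of `X`, as a submodule. -/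
def genEigen (f : X →ₗ⁅K,𝔤⁆ X) (c : K) : LieSubmodule K 𝔤 X :=
  { Module.End.maxGenEigenspace (f : Module.End K X) c with
    lie_mem := fun {x _} hm => Module.End.mapsTo_maxGenEigenspace_of_comm
      (g := LieModule.toEnd K 𝔤 X x) (LinearMap.ext fun v => f.map_lie x v) c hm }

theorem mem_genEigen {f : X →ₗ⁅K,𝔤⁆ X} {c : K} {v : X} :
    v ∈ genEigen f c ↔ ∃ n : ℕ, (((f : Module.End K X) - c • 1) ^ n) v = 0 :=
  Module.End.mem_maxGenEigenspace _ _ _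

/-- Every endomorphism of an indecomposable object has a single generalized eigenvalue. -/
theorem exists_genEigen_eq_top [IsAlgClosed K] (hX : InExtendedO 𝔥 𝔟 X) (hind : IsIndecomposableModule K 𝔤 X)
    (f : X →ₗ⁅K,𝔤⁆ X) : ∃ c : K, genEigen f c = ⊤ := by
  have hsup : ⨆ c, genEigen f c = ⊤ := by
    rw [← LieSubmodule.toSubmodule_inj, LieSubmodule.iSup_toSubmodule]
    exact iSup_maxGenEigenspace_eq_top hX.span hX.finiteDimensional f
      fun μ v hv => map_mem_weightSpaceOf f hv
  have hindep : iSupIndep fun c => genEigen f c := by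
    rw [← LieSubmodule.iSupIndep_toSubmodule]
    exact Module.End.independent_maxGenEigenspace _
  have := hind.nonzero
  obtain ⟨c, hc⟩ : ∃ c, genEigen f c ≠ ⊥ := by
    by_contra! hcon
    simp only [hcon, iSup_bot] at hsup
    exact bot_ne_top hsup
  refine ⟨c, ?_⟩
  have hcompl := isCompl_iSup_ne hindep hsup c
  have := (hind.indecomposable _ _ hcompl).resolve_left hc
  rw [this] at hcompl
  simpa using hcompl.sup_eq_top

/-- The kernel of `f - d` lies in the generalized eigenspace for `d`, which meets the one for `c`
trivially. -/
theorem injective_sub_smul (f : X →ₗ⁅K,𝔤⁆ X) {c d : K} (hf : genEigen f c = ⊤) (hcd : c ≠ d) :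
    Function.Injective (f - d • LieModuleHom.id : X →ₗ⁅K,𝔤⁆ X) := by
  rw [injective_iff_map_eq_zero]
  intro v hv
  have h1 : v ∈ genEigen f d := mem_genEigen.mpr ⟨1, by simpa using hv⟩
  have h2 : v ∈ genEigen f c := hf ▸ LieSubmodule.mem_top v
  have := Module.End.disjoint_genEigenspace (f : Module.End K X) hcd ⊤ ⊤
  exact (Submodule.disjoint_def.mp this) v h2 h1

theorem InExtendedO.bijective_of_injective (hX : InExtendedO 𝔥 𝔟 X) {f : X →ₗ⁅K,𝔤⁆ X}
    (hf : Function.Injective f) : Function.Bijective f :=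
  ⟨hf, surjective_of_injective_of_iSup_eq_top hX.span hX.finiteDimensional
    (f := (f : Module.End K X)) (fun _ _ hv => map_mem_weightSpaceOf f hv) hf⟩

theorem mem_moduleEnd_iff {f : Module.End K X} :
    f ∈ moduleEnd K 𝔤 X ↔ ∀ (x : 𝔤) (v : X), f ⁅x, v⁆ = ⁅x, f v⁆ := by
  rw [Subalgebra.mem_centralizer_iff]
  simp only [Set.forall_mem_range, LinearMap.ext_iff, Module.End.mul_apply,
    LieModule.toEnd_apply_apply]
  exact ⟨fun h x v => (h x v).symm, fun h x v => (h x v).symm⟩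

theorem isUnit_moduleEnd {f : Module.End K X} (hf : f ∈ moduleEnd K 𝔤 X)
    (hbij : Function.Bijective f) : IsUnit (⟨f, hf⟩ : moduleEnd K 𝔤 X) := by
  obtain ⟨g, hg⟩ : ∃ g : (Module.End K X)ˣ, (g : Module.End K X) = f :=
    (Module.End.isUnit_iff f).mpr hbij
  subst hg
  have hinv : (↑g⁻¹ : Module.End K X) ∈ moduleEnd K 𝔤 X := by
    rw [mem_moduleEnd_iff] at hf ⊢
    intro x v
    apply hbij.1
    have e (w : X) : (g : Module.End K X) ((↑g⁻¹ : Module.End K X) w) = w := by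
      rw [← Module.End.mul_apply, Units.mul_inv, Module.End.one_apply]
    rw [hf, e, e]
  exact ⟨⟨⟨g, hf⟩, ⟨_, hinv⟩, Subtype.ext g.mul_inv, Subtype.ext g.inv_mul⟩, rfl⟩

/-- Let a + b = 1, and let c be the only generalized eigenvalue of a. If c ≠ 0, then a is
invertible; if c = 0, then a - 1 = -b is. -/
theorem InExtendedO.isLocalRing [IsAlgClosed K] (hX : InExtendedO 𝔥 𝔟 X)
    (hind : IsIndecomposableModule K 𝔤 X) :
    IsLocalRing (moduleEnd K 𝔤 X) := by
  have := hind.nonzero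
  have : Nontrivial (moduleEnd K 𝔤 X) := inferInstance
  refine ⟨fun {a b} hab => ?_⟩
  obtain ⟨a, ha⟩ := a
  obtain ⟨b, hb⟩ := b
  have hab : a + b = 1 := congrArg Subtype.val hab
  let f : X →ₗ⁅K,𝔤⁆ X := { a with map_lie' := fun {x m} => mem_moduleEnd_iff.mp ha x m }
  obtain ⟨c, hc⟩ := exists_genEigen_eq_top hX hind f
  by_cases h0 : c = 0
  · right
    refine isUnit_moduleEnd hb ?_
    have h1 := hX.bijective_of_injective (injective_sub_smul f (d := 1) hc (by simp [h0]))
    have h2 : (f - (1 : K) • LieModuleHom.id : X →ₗ⁅K,𝔤⁆ X) = -(b : X → X) := by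
      ext v
      rw [eq_sub_of_add_eq' hab]
      simp [f]
    rw [h2] at h1
    exact neg_involutive.bijective.of_comp_iff' _ |>.mp h1
  · left
    refine isUnit_moduleEnd ha ?_
    have h1 := hX.bijective_of_injective (injective_sub_smul f (d := 0) hc h0)
    rw [zero_smul, sub_zero] at h1
    exact h1

end Modules

/-! ### Existence: joint eigenspaces of a maximal set of commuting idempotents. -/

section Existence

open Polynomial in
-- An idempotent is annihilated by the squarefree polynomial X(X - 1), so it is semisimple and its
-- generalized eigenvectors are eigenvectors. Joint generalized eigenspaces of idempotents are
-- therefore honest joint eigenspaces.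
theorem apply_eq_smul_of_mem_maxGenEigenspace {K V : Type*} [Field K]
    [AddCommGroup V] [Module K V] {e : Module.End K V} (he : IsIdempotentElem e) {c : K} {v : V}
    (hv : v ∈ e.maxGenEigenspace c) : e v = c • v := by
  have hsq : Squarefree ((X : K[X]) * (X - C 1)) := by
    refine (separable_X.mul (separable_X_sub_C) ?_).squarefree
    simpa using isCoprime_X_sub_C_of_isUnit_sub (a := (0 : K)) (b := 1) (by simp)
  have hss : e.IsSemisimple := Module.End.isSemisimple_of_squarefree_aeval_eq_zero hsq <| by
    simp [mul_sub, he.eq]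
  rw [hss.isFinitelySemisimple.maxGenEigenspace_eq_eigenspace] at hv
  exact Module.End.mem_eigenspace_iff.mp hv

variable {K 𝔤 : Type*} [Field K] [LieRing 𝔤] [LieAlgebra K 𝔤] {𝔥 𝔟 : LieSubalgebra K 𝔤}
  {X : Type*} [AddCommGroup X] [Module K X] [LieRingModule 𝔤 X] [LieModule K 𝔤 X]

variable (𝔤) in
/-- Sets of pairwise commuting idempotents of the endomorphism ring of `X`. -/
structure IsCommutingIdempotents (B : Set (Module.End K X)) : Prop where
  mem : ∀ e ∈ B, e ∈ moduleEnd K 𝔤 X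
  idempotent : ∀ e ∈ B, IsIdempotentElem e
  commute : ∀ e ∈ B, ∀ f ∈ B, Commute e f

variable (𝔤 X) in
theorem exists_maximal_commutingIdempotents :
    ∃ B : Set (Module.End K X), Maximal (IsCommutingIdempotents 𝔤) B := by
  refine zorn_subset {B | IsCommutingIdempotents 𝔤 B} fun c hc hchain =>
    ⟨⋃₀ c, ⟨?_, ?_, ?_⟩, fun s hs => Set.subset_sUnion_of_mem hs⟩
  · rintro e ⟨s, hs, he⟩
    exact (hc hs).mem e he
  · rintro e ⟨s, hs, he⟩
    exact (hc hs).idempotent e he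
  · rintro e ⟨s, hs, he⟩ f ⟨t, ht, hf⟩
    rcases hchain.total hs ht with h | h
    · exact (hc ht).commute e (h he) f hf
    · exact (hc hs).commute e he f (h hf)

/-- The joint eigenspace of a set of commuting idempotents, as a submodule. -/
def jointEigenspace {B : Set (Module.End K X)} (hB : IsCommutingIdempotents 𝔤 B) (χ : B → K) :
    LieSubmodule K 𝔤 X :=
  { ⨅ e : B, (e : Module.End K X).maxGenEigenspace (χ e) with
    lie_mem := fun {x m} hm => by
      simp only [Submodule.carrier_eq_coe, SetLike.mem_coe, Submodule.mem_iInf] at hm ⊢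
      exact fun e => Module.End.mapsTo_maxGenEigenspace_of_comm
        (g := LieModule.toEnd K 𝔤 X x)
        (LinearMap.ext fun v => mem_moduleEnd_iff.mp (hB.mem e e.2) x v) (χ e) (hm e) }

section

variable {B : Set (Module.End K X)} {hB : IsCommutingIdempotents 𝔤 B} {χ : B → K}

theorem apply_of_mem_jointEigenspace {v : X} (hv : v ∈ jointEigenspace hB χ) (e : B) :
    (e : Module.End K X) v = χ e • v :=
  apply_eq_smul_of_mem_maxGenEigenspace (hB.idempotent e e.2)
    ((Submodule.mem_iInf _).mp hv e)

theorem iSupIndep_jointEigenspace (hB : IsCommutingIdempotents 𝔤 B) :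
    iSupIndep (jointEigenspace hB) := by
  rw [← LieSubmodule.iSupIndep_toSubmodule]
  exact Module.End.independent_iInf_maxGenEigenspace_of_forall_mapsTo
    (fun e : B => (e : Module.End K X)) fun e f c =>
      Module.End.mapsTo_maxGenEigenspace_of_comm (hB.commute f f.2 e e.2) c

theorem iSup_jointEigenspace [IsAlgClosed K] (hX : InExtendedO 𝔥 𝔟 X)
    (hB : IsCommutingIdempotents 𝔤 B) : ⨆ χ, jointEigenspace hB χ = ⊤ := by
  rw [← LieSubmodule.toSubmodule_inj, LieSubmodule.iSup_toSubmodule]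
  refine iSup_iInf_maxGenEigenspace_eq_top hX.span hX.finiteDimensional
    (fun e : B => (e : Module.End K X)) (fun e μ v hv => ?_)
    fun e f => hB.commute e e.2 f f.2
  let f : X →ₗ⁅K,𝔤⁆ X :=
    { (e : Module.End K X) with map_lie' := fun {x m} => mem_moduleEnd_iff.mp (hB.mem e e.2) x m }
  exact map_mem_weightSpaceOf f hv

/-- A splitting W = N ⊕ P of the joint eigenspace yields the idempotent `e` that projects onto N
along P and all other joint eigenspaces. It commutes with `B`, so by maximality it belongs to `B`
and acts on W as a scalar. If the scalar is 0, then N = 0; otherwise P = 0. -/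
theorem indecomposable_jointEigenspace [IsAlgClosed K] (hX : InExtendedO 𝔥 𝔟 X)
    (hB : Maximal (IsCommutingIdempotents 𝔤) B) {χ : B → K}
    (hχ : jointEigenspace hB.prop χ ≠ ⊥) :
    IsIndecomposableModule K 𝔤 (jointEigenspace hB.prop χ) := by
  refine ⟨(LieSubmodule.nontrivial_iff_ne_bot K 𝔤 X).mpr hχ, ?_⟩
  have hW := isCompl_iSup_ne (iSupIndep_jointEigenspace hB.prop) (iSup_jointEigenspace hX hB.prop) χ
  set W := jointEigenspace hB.prop χ
  intro N P hNP
  let e : X →ₗ⁅K,𝔤⁆ X := W.incl.comp (N.incl.comp ((projOnto hNP).comp (projOnto hW)))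
  have heW (w : W) : e w = (projOnto hNP w : W) := by
    change ((projOnto hNP (projOnto hW (w : X)) : W) : X) = _
    rw [projOnto_of_mem_left hW w.2]
  -- `f` preserves both W and the sum of the other joint eigenspaces, so it commutes with the
  -- projection onto W, where it is the scalar `χ f`.
  have hinv (f : B) (v : X) :
      projOnto hW ((f : Module.End K X) v) = χ f • projOnto hW v := by
    have hle : (⨆ (χ') (_ : χ' ≠ χ), jointEigenspace hB.prop χ').toSubmodule ≤
        (⨆ (χ') (_ : χ' ≠ χ), jointEigenspace hB.prop χ').toSubmodule.comap
          (f : Module.End K X) := by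
      simp only [LieSubmodule.iSup_toSubmodule]
      refine iSup₂_le fun χ' hχ' w hw => ?_
      rw [Submodule.mem_comap, apply_of_mem_jointEigenspace hw f]
      exact Submodule.smul_mem _ _
        (le_iSup₂ (f := fun χ' (_ : χ' ≠ χ) => (jointEigenspace hB.prop χ').toSubmodule) χ' hχ' hw)
    have h1 := projection_commute (LieSubmodule.isCompl_toSubmodule.mpr hW)
      (f := (f : Module.End K X))
      (fun w hw => by rw [apply_of_mem_jointEigenspace hw f]; exact W.smul_mem _ hw) hle v
    refine Subtype.ext (h1.trans ?_)
    exact apply_of_mem_jointEigenspace (projOnto hW v).2 f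
  have hcomm (f : B) : Commute (e : Module.End K X) f := by
    refine LinearMap.ext fun v => ?_
    have h1 : e ((f : Module.End K X) v) = χ f • e v := by
      change ((projOnto hNP (projOnto hW ((f : Module.End K X) v)) : W) : X) = _
      rw [hinv, map_smul]
      rfl
    exact h1.trans (apply_of_mem_jointEigenspace
      (projOnto hNP (projOnto hW v) : W).2 f).symm
  have hidem : IsIdempotentElem (e : Module.End K X) := by
    refine LinearMap.ext fun v => ?_
    change e (((projOnto hNP (projOnto hW v) : N) : W) : X) = _
    rw [heW, projOnto_of_mem_left hNP (projOnto hNP (projOnto hW v)).2]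
    rfl
  have heB : (e : Module.End K X) ∈ B := by
    refine hB.le_of_ge (y := insert (e : Module.End K X) B) ⟨?_, ?_, ?_⟩
      (Set.subset_insert _ _) (Set.mem_insert _ _)
    · rintro f (rfl | hf)
      · exact mem_moduleEnd_iff.mpr fun x v => e.map_lie x v
      · exact hB.prop.mem f hf
    · rintro f (rfl | hf)
      · exact hidem
      · exact hB.prop.idempotent f hf
    · rintro f (rfl | hf) g (rfl | hg)
      · exact Commute.refl _
      · exact hcomm ⟨g, hg⟩
      · exact (hcomm ⟨f, hf⟩).symm
      · exact hB.prop.commute f hf g hg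
  have hscalar (w : W) : ((projOnto hNP w : W) : X) = χ ⟨_, heB⟩ • (w : X) :=
    (heW w).symm.trans (apply_of_mem_jointEigenspace w.2 ⟨_, heB⟩)
  by_cases h0 : χ ⟨_, heB⟩ = 0
  · left
    rw [LieSubmodule.eq_bot_iff]
    intro w hw
    have := hscalar w
    rw [projOnto_of_mem_left hNP hw, h0, zero_smul] at this
    exact Subtype.ext this
  · right
    rw [LieSubmodule.eq_bot_iff]
    intro w hw
    have := hscalar w
    rw [projOnto_of_mem_right hNP hw] at this
    exact Subtype.ext ((smul_eq_zero.mp this.symm).resolve_left h0)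

end

theorem InExtendedO.exists_decomposition [IsAlgClosed K] {M : Type w} [AddCommGroup M] [Module K M]
    [LieRingModule 𝔤 M] [LieModule K 𝔤 M] (hM : InExtendedO 𝔥 𝔟 M) :
    ∃ (J : Type w) (D : J → LieSubmodule K 𝔤 M), IsIndecomposableDecomposition 𝔥 𝔟 D := by
  obtain ⟨B, hB⟩ := exists_maximal_commutingIdempotents 𝔤 M (K := K)
  -- Indexing by submodules rather than by functions `B → K` keeps `J` in the universe of `M`.
  let J := {N : LieSubmodule K 𝔤 M // ∃ χ, jointEigenspace hB.prop χ = N ∧ N ≠ ⊥}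
  refine ⟨J, Subtype.val, ?_, ?_, ?_, ?_⟩
  · rw [LieSubmodule.iSupIndep_toSubmodule]
    choose χ hχ using fun j : J => j.2
    have : (Subtype.val : J → _) = jointEigenspace hB.prop ∘ χ := funext fun j => (hχ j).1.symm
    rw [this]
    refine (iSupIndep_jointEigenspace hB.prop).comp fun i j hij => Subtype.ext ?_
    rw [← (hχ i).1, ← (hχ j).1, hij]
  · rw [LieSubmodule.iSup_toSubmodule_eq_top, eq_top_iff, ← iSup_jointEigenspace hM hB.prop]
    refine iSup_le fun χ => ?_
    by_cases h : jointEigenspace hB.prop χ = ⊥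
    · rw [h]; exact bot_le
    · exact le_iSup (Subtype.val : J → _) ⟨_, χ, rfl, h⟩
  · rintro ⟨_, χ, rfl, h⟩
    exact hM.of_isCompl (isCompl_iSup_ne (iSupIndep_jointEigenspace hB.prop)
      (iSup_jointEigenspace hM hB.prop) χ)
  · rintro ⟨_, χ, rfl, h⟩
    exact indecomposable_jointEigenspace hM hB h

end Existence

/-! ### Uniqueness: traces on weight spaces and components of a decomposition. -/

section Uniqueness

variable {K 𝔤 : Type*} [Field K] [LieRing 𝔤] [LieAlgebra K 𝔤] {𝔥 𝔟 : LieSubalgebra K 𝔤}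
  {X : Type*} [AddCommGroup X] [Module K X] [LieRingModule 𝔤 X] [LieModule K 𝔤 X]
  {Y : Type*} [AddCommGroup Y] [Module K Y] [LieRingModule 𝔤 Y] [LieModule K 𝔤 Y]
  {M : Type*} [AddCommGroup M] [Module K M] [LieRingModule 𝔤 M] [LieModule K 𝔤 M]

/-- The restriction of endomorphisms of `X` to a weight space. -/
def weightRestrict (μ : Module.Dual K 𝔥) :
    (X →ₗ⁅K,𝔤⁆ X) →ₗ[K] Module.End K (weightSpaceOf 𝔥 X μ) where
  toFun f := (f : X →ₗ[K] X).restrict fun _ hv => map_mem_weightSpaceOf f hv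
  map_add' _ _ := rfl
  map_smul' _ _ := rfl

/-- The trace of endomorphisms of `X` on a weight space. -/
noncomputable def weightTrace (μ : Module.Dual K 𝔥) : (X →ₗ⁅K,𝔤⁆ X) →ₗ[K] K :=
  LinearMap.trace K (weightSpaceOf 𝔥 X μ) ∘ₗ weightRestrict μ

theorem weightTrace_id (μ : Module.Dual K 𝔥) [FiniteDimensional K (weightSpaceOf 𝔥 X μ)] :
    weightTrace μ (LieModuleHom.id : X →ₗ⁅K,𝔤⁆ X) =
      Module.finrank K (weightSpaceOf 𝔥 X μ) := by
  rw [← LinearMap.trace_one]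
  rfl

/-- Here `f` is locally nilpotent, so its restriction to a finite-dimensional weight space is
nilpotent. -/
theorem weightTrace_eq_zero (hX : InExtendedO 𝔥 𝔟 X) (μ : Module.Dual K 𝔥) {f : X →ₗ⁅K,𝔤⁆ X}
    (hf : genEigen f 0 = ⊤) : weightTrace μ f = 0 := by
  have := hX.finiteDimensional μ
  refine (LinearMap.isNilpotent_trace_of_isNilpotent ?_).eq_zero
  rw [Module.End.isNilpotent_iff_of_finite]
  intro v
  have hv : (v : X) ∈ genEigen f 0 := hf ▸ LieSubmodule.mem_top _
  obtain ⟨n, hn⟩ := mem_genEigen.mp hv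
  refine ⟨n, Subtype.ext ?_⟩
  rw [zero_smul, sub_zero] at hn
  refine Eq.trans ?_ hn
  have hpow := Module.End.pow_restrict (f' := (f : Module.End K X)) n
    (fun _ hv => map_mem_weightSpaceOf (μ := μ) f hv)
  exact congrArg Subtype.val (LinearMap.congr_fun hpow v)

theorem bijective_of_weightTrace_ne_zero [IsAlgClosed K] (hX : InExtendedO 𝔥 𝔟 X)
    (hind : IsIndecomposableModule K 𝔤 X) {μ : Module.Dual K 𝔥} {f : X →ₗ⁅K,𝔤⁆ X}
    (hf : weightTrace μ f ≠ 0) : Function.Bijective f := by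
  obtain ⟨c, hc⟩ := exists_genEigen_eq_top hX hind f
  have h0 : c ≠ 0 := by
    rintro rfl
    exact hf (weightTrace_eq_zero hX μ hc)
  have h1 := hX.bijective_of_injective (injective_sub_smul f hc h0)
  rwa [zero_smul, sub_zero] at h1

/-- Write f = c + n and g = d + m with n, m locally nilpotent. Then n, m and nm have trace 0, so the
traces of f, g and fg are c, d and cd times the trace of the identity. -/
theorem weightTrace_comp [IsAlgClosed K] (hX : InExtendedO 𝔥 𝔟 X)
    (hind : IsIndecomposableModule K 𝔤 X) (μ : Module.Dual K 𝔥) (f g : X →ₗ⁅K,𝔤⁆ X) :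
    weightTrace μ f * weightTrace μ g =
      weightTrace μ (LieModuleHom.id : X →ₗ⁅K,𝔤⁆ X) * weightTrace μ (f.comp g) := by
  have hshift {h : X →ₗ⁅K,𝔤⁆ X} {c : K} (hc : genEigen h c = ⊤) :
      genEigen (h - c • LieModuleHom.id) 0 = ⊤ := by
    rw [eq_top_iff, ← hc]
    intro v hv
    rw [mem_genEigen] at hv ⊢
    rwa [zero_smul, sub_zero]
  obtain ⟨c, hc⟩ := exists_genEigen_eq_top hX hind f
  obtain ⟨d, hd⟩ := exists_genEigen_eq_top hX hind g
  replace hc := hshift hc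
  replace hd := hshift hd
  set n := f - c • LieModuleHom.id with hn
  set m := g - d • LieModuleHom.id with hm
  have hnm : weightTrace μ (n.comp m) = 0 := by
    by_contra hne
    -- A nonzero trace would make nm bijective and so m injective, which a locally nilpotent map on
    -- a nonzero space is not.
    have hinj : Function.Injective m :=
      (bijective_of_weightTrace_ne_zero hX hind hne).1.of_comp (f := n)
    have := hind.nonzero
    obtain ⟨v, hv⟩ := exists_ne (0 : X)
    have hv' : v ∈ genEigen m 0 := hd ▸ LieSubmodule.mem_top _
    obtain ⟨k, hk⟩ := mem_genEigen.mp hv'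
    rw [zero_smul, sub_zero, Module.End.pow_apply] at hk
    refine hv (hinj.iterate k (hk.trans ?_))
    rw [← LieModuleHom.coe_toLinearMap, ← Module.End.pow_apply, map_zero]
  have hn0 := weightTrace_eq_zero hX μ hc
  have hm0 := weightTrace_eq_zero hX μ hd
  have hf : f = n + c • LieModuleHom.id := by rw [hn, sub_add_cancel]
  have hg : g = m + d • LieModuleHom.id := by rw [hm, sub_add_cancel]
  have hfg : f.comp g = n.comp m + d • n + c • m + (c * d) • LieModuleHom.id := by
    ext v
    simp only [hf, hg, LieModuleHom.comp_apply, LieModuleHom.add_apply, LieModuleHom.smul_apply,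
      LieModuleHom.id_apply, map_add, map_smul, smul_add, smul_smul, mul_comm c d]
    abel
  rw [hfg, hf, hg]
  simp only [map_add, map_smul, hn0, hm0, hnm, smul_eq_mul]
  ring

/-- If an automorphism factors through an indecomposable module, then the first factor
is an isomorphism. -/
theorem bijective_of_comp_bijective {Z : Type*} [AddCommGroup Z] [Module K Z]
    [LieRingModule 𝔤 Z] [Nontrivial Z] (hind : IsIndecomposableModule K 𝔤 Y)
    {f : Z →ₗ⁅K,𝔤⁆ Y} {g : Y →ₗ⁅K,𝔤⁆ Z} (h : Function.Bijective (g.comp f)) :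
    Function.Bijective f := by
  have hinj : Function.Injective f := h.1.of_comp (f := g)
  -- Since gf is bijective, f splits off its range as a direct summand of `Y`, with complement the
  -- kernel of g.
  have hcompl : IsCompl f.range g.ker := by
    constructor
    · rw [disjoint_iff, LieSubmodule.eq_bot_iff]
      rintro _ ⟨⟨x, rfl⟩, hx⟩
      have : x = 0 := h.1 (hx.trans (map_zero (g.comp f)).symm)
      rw [this]
      exact map_zero f
    · rw [codisjoint_iff, eq_top_iff]
      intro y _
      obtain ⟨x, hx⟩ := h.2 (g y)
      rw [LieSubmodule.mem_sup]
      refine ⟨f x, ⟨x, rfl⟩, y - f x, ?_, add_sub_cancel _ _⟩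
      rw [LieModuleHom.mem_ker, map_sub, sub_eq_zero, ← hx]
      rfl
  refine ⟨hinj, ?_⟩
  rcases hind.indecomposable _ _ hcompl with h0 | h0
  · exfalso
    obtain ⟨x, hx⟩ := exists_ne (0 : Z)
    have h1 : f x ∈ f.range := ⟨x, rfl⟩
    rw [h0, LieSubmodule.mem_bot] at h1
    exact hx (hinj (h1.trans (map_zero f).symm))
  · rw [h0] at hcompl
    have := hcompl.sup_eq_top
    rw [sup_bot_eq] at this
    exact (LieModuleHom.range_eq_top f).mp this

section Decomposition

variable {J : Type*} {D : J → LieSubmodule K 𝔤 M}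

theorem IsIndecomposableDecomposition.isCompl (hD : IsIndecomposableDecomposition 𝔥 𝔟 D) (j : J) :
    IsCompl (D j) (⨆ (i) (_ : i ≠ j), D i) :=
  isCompl_iSup_ne (LieSubmodule.iSupIndep_toSubmodule.mp hD.independent)
    (LieSubmodule.iSup_toSubmodule_eq_top.mp hD.span) j

/-- The projection onto a component of a decomposition. -/
noncomputable def IsIndecomposableDecomposition.proj
    (hD : IsIndecomposableDecomposition 𝔥 𝔟 D) (j : J) : M →ₗ⁅K,𝔤⁆ D j :=
  projOnto (hD.isCompl j)

theorem IsIndecomposableDecomposition.proj_self (hD : IsIndecomposableDecomposition 𝔥 𝔟 D) {j : J}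
    (v : D j) : hD.proj j (v : M) = v :=
  projOnto_of_mem_left _ v.2

theorem IsIndecomposableDecomposition.proj_of_ne (hD : IsIndecomposableDecomposition 𝔥 𝔟 D)
    {i j : J} (h : i ≠ j) (v : D i) : hD.proj j (v : M) = 0 :=
  projOnto_of_mem_right _ <|
    (le_iSup₂ (f := fun i (_ : i ≠ j) => D i) i h : D i ≤ _) v.2

/-- Allowing every larger `t` makes the claim additive in `v`: the finite sets of two vectors can be
united. -/
theorem IsIndecomposableDecomposition.exists_sum_proj (hD : IsIndecomposableDecomposition 𝔥 𝔟 D)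
    (v : M) : ∃ s : Finset J, ∀ t, s ⊆ t → ∑ j ∈ t, (hD.proj j v : M) = v := by
  classical
  have hv : v ∈ ⨆ j, (D j).toSubmodule := hD.span ▸ Submodule.mem_top
  refine Submodule.iSup_induction _ (motive := fun v => ∃ s : Finset J, ∀ t, s ⊆ t →
    ∑ j ∈ t, (hD.proj j v : M) = v) hv (fun i v hv => ?_) ?_ ?_
  · refine ⟨{i}, fun t ht => ?_⟩
    rw [Finset.sum_eq_single_of_mem i (ht (Finset.mem_singleton_self i))]
    · exact congrArg Subtype.val (hD.proj_self ⟨v, hv⟩)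
    · intro j _ hj
      exact congrArg Subtype.val (hD.proj_of_ne hj.symm ⟨v, hv⟩)
  · exact ⟨∅, fun t _ => by simp⟩
  · rintro v w ⟨s, hs⟩ ⟨s', hs'⟩
    refine ⟨s ∪ s', fun t ht => ?_⟩
    simp only [map_add, LieSubmodule.coe_add, Finset.sum_add_distrib]
    rw [hs t (Finset.union_subset_left ht), hs' t (Finset.union_subset_right ht)]

/-- Only finitely many components contribute to a given weight space. -/
theorem IsIndecomposableDecomposition.exists_finset (hM : InExtendedO 𝔥 𝔟 M)
    (hD : IsIndecomposableDecomposition 𝔥 𝔟 D) (μ : Module.Dual K 𝔥) :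
    ∃ S : Finset J, (∀ j, weightSpaceOf 𝔥 (D j) μ ≠ ⊥ → j ∈ S) ∧
      ∀ v ∈ weightSpaceOf 𝔥 M μ, ∑ j ∈ S, (hD.proj j v : M) = v := by
  classical
  have := hM.finiteDimensional μ
  -- The traces of the components on the weight space are independent subspaces of a
  -- finite-dimensional space, so only finitely many are nonzero.
  have hindep : iSupIndep fun j =>
      (D j).toSubmodule.comap (weightSpaceOf 𝔥 M μ).subtype :=
    iSupIndep_of_map_le (Submodule.injective_subtype _) hD.independent
      fun j => Submodule.map_comap_le _ _
  have hfin := WellFoundedGT.finite_ne_bot_of_iSupIndep hindep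
  have hmem (j : J) (hj : weightSpaceOf 𝔥 (D j) μ ≠ ⊥) : j ∈ hfin.toFinset := by
    rw [Set.Finite.mem_toFinset, Set.mem_ofPred_eq]
    obtain ⟨v, hv, hv0⟩ := Submodule.exists_mem_ne_zero_of_ne_bot hj
    refine (Submodule.ne_bot_iff _).mpr
      ⟨⟨v, map_mem_weightSpaceOf (D j).incl hv⟩, v.2, fun h => hv0 (Subtype.ext ?_)⟩
    exact congrArg (fun w : weightSpaceOf 𝔥 M μ => (w : M)) h
  refine ⟨hfin.toFinset, hmem, fun v hv => ?_⟩
  obtain ⟨s, hs⟩ := hD.exists_sum_proj v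
  refine (Finset.sum_subset Finset.subset_union_right fun j _ hj => ?_).trans
    (hs (s ∪ hfin.toFinset) Finset.subset_union_left)
  have h0 : weightSpaceOf 𝔥 (D j) μ = ⊥ := by
    by_contra h
    exact hj (hmem j h)
  have h1 := map_mem_weightSpaceOf (hD.proj j) hv
  rw [h0, Submodule.mem_bot] at h1
  rw [h1, LieSubmodule.coe_zero]

end Decomposition

end Uniqueness

/-! ### Comparison of multiplicities and the bijection between two decompositions. -/

section KrullSchmidt

variable {K 𝔤 : Type*} [Field K] [IsAlgClosed K]
  [LieRing 𝔤] [LieAlgebra K 𝔤] {𝔥 𝔟 : LieSubalgebra K 𝔤}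
  {X : Type*} [AddCommGroup X] [Module K X] [LieRingModule 𝔤 X] [LieModule K 𝔤 X]
  {M : Type*} [AddCommGroup M] [Module K M] [LieRingModule 𝔤 M] [LieModule K 𝔤 M]
  {J : Type*} {D : J → LieSubmodule K 𝔤 M} {J' : Type*} {D' : J' → LieSubmodule K 𝔤 M}

/-- The trace of an endomorphism of `X` that factors through `M` only sees the components of `M`
isomorphic to `X`. -/
theorem exists_finset_weightTrace_eq_sum (hX : InExtendedO 𝔥 𝔟 X)
    (hind : IsIndecomposableModule K 𝔤 X) (hM : InExtendedO 𝔥 𝔟 M)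
    (hD : IsIndecomposableDecomposition 𝔥 𝔟 D) {μ : Module.Dual K 𝔥}
    (hμ : weightSpaceOf 𝔥 X μ ≠ ⊥) :
    ∃ S : Finset J, (∀ j, j ∈ S ↔ Nonempty (X ≃ₗ⁅K,𝔤⁆ D j)) ∧
      ∀ (p : M →ₗ⁅K,𝔤⁆ X) (q : X →ₗ⁅K,𝔤⁆ M), weightTrace μ (p.comp q) =
        ∑ j ∈ S, weightTrace μ ((p.comp (D j).incl).comp ((hD.proj j).comp q)) := by
  classical
  have := hind.nonzero
  obtain ⟨S, hS, hsum⟩ := hD.exists_finset hM μ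
  refine ⟨S.filter fun j => Nonempty (X ≃ₗ⁅K,𝔤⁆ D j), fun j => ?_, fun p q => ?_⟩
  · rw [Finset.mem_filter]
    -- A component isomorphic to `X` has a nonzero μ-weight space, so it already lies in the finite
    -- set `S`.
    refine ⟨And.right, fun h => ⟨hS j fun hj => hμ ?_, h⟩⟩
    obtain ⟨e⟩ := h
    rw [Submodule.eq_bot_iff] at hj ⊢
    intro v hv
    exact e.injective ((hj (e v) (map_mem_weightSpaceOf e.toLieModuleHom hv)).trans
      (map_zero e).symm)
  -- A nonzero term makes X → D j → X bijective, which forces X ≅ D j; the terms dropped by the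
  -- filter vanish.
  · rw [Finset.sum_filter_of_ne]
    · rw [← map_sum]
      refine congrArg (LinearMap.trace K (weightSpaceOf 𝔥 X μ))
        (LinearMap.ext fun v => Subtype.ext ?_)
      have h1 := congrArg p (hsum (q v) (map_mem_weightSpaceOf q v.2))
      rw [map_sum] at h1
      rw [map_sum, LinearMap.sum_apply, Submodule.coe_sum]
      exact h1.symm
    · intro j _ hj
      exact ⟨equivOfBijective _ (bijective_of_comp_bijective (hD.indecomposable j)
        (bijective_of_weightTrace_ne_zero hX hind hj))⟩

/-- The maps p_a q_a' are the identity for a = a' and 0 otherwise. Expanding their traces over the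
copies of `X` in `D'` factors a nonzero scalar matrix of size |A| through K^B, so |A| ≤ |B|.
Characteristic 0 makes d = dim X^μ nonzero in K. -/
theorem card_le_card_of_iso [CharZero K] (hX : InExtendedO 𝔥 𝔟 X)
    (hind : IsIndecomposableModule K 𝔤 X)
    (hD : IsIndecomposableDecomposition 𝔥 𝔟 D) (hD' : IsIndecomposableDecomposition 𝔥 𝔟 D')
    {A : Finset J} (hA : ∀ j ∈ A, Nonempty (X ≃ₗ⁅K,𝔤⁆ D j))
    {B : Finset J'} (hB : ∀ j ∈ B, Nonempty (X ≃ₗ⁅K,𝔤⁆ D' j))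
    {μ : Module.Dual K 𝔥} (hμ : weightSpaceOf 𝔥 X μ ≠ ⊥)
    (hsum : ∀ (p : M →ₗ⁅K,𝔤⁆ X) (q : X →ₗ⁅K,𝔤⁆ M), weightTrace μ (p.comp q) =
        ∑ j ∈ B, weightTrace μ ((p.comp (D' j).incl).comp ((hD'.proj j).comp q))) :
    A.card ≤ B.card := by
  classical
  have := hX.finiteDimensional μ
  set d : K := weightTrace μ (LieModuleHom.id : X →ₗ⁅K,𝔤⁆ X) with hd
  have hd0 : d ≠ 0 := by
    rw [hd, weightTrace_id, Nat.cast_ne_zero]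
    exact fun h => hμ (Submodule.finrank_eq_zero.mp h)
  let α (a : A) : X ≃ₗ⁅K,𝔤⁆ D a := (hA a a.2).some
  let β (b : B) : X ≃ₗ⁅K,𝔤⁆ D' b := (hB b b.2).some
  let p (a : A) : M →ₗ⁅K,𝔤⁆ X := (α a).symm.toLieModuleHom.comp (hD.proj a)
  let q (a : A) : X →ₗ⁅K,𝔤⁆ M := (D a).incl.comp (α a).toLieModuleHom
  let P : Matrix A B K := fun a b =>
    weightTrace μ ((p a).comp ((D' b).incl.comp (β b).toLieModuleHom))
  let Q : Matrix B A K := fun b a =>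
    weightTrace μ ((β b).symm.toLieModuleHom.comp ((hD'.proj b).comp (q a)))
  -- One factor d comes from `weightTrace_comp`, the other is the trace of p_a q_a = id.
  have hPQ : P * Q = (d * d) • (1 : Matrix A A K) := by
    ext a a'
    have h1 (b : B) : P a b * Q b a' =
        d * weightTrace μ (((p a).comp (D' b).incl).comp ((hD'.proj b).comp (q a'))) := by
      rw [weightTrace_comp hX hind]
      congr 2
      ext v
      exact congrArg (fun w : D' b => p a (w : M)) ((β b).apply_symm_apply _)
    rw [Matrix.mul_apply, Finset.sum_congr rfl fun b _ => h1 b, ← Finset.mul_sum,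
      Finset.sum_coe_sort B fun j =>
        weightTrace μ (((p a).comp (D' j).incl).comp ((hD'.proj j).comp (q a'))),
      ← hsum, Matrix.smul_apply, smul_eq_mul, mul_assoc, Matrix.one_apply]
    congr 1
    split_ifs with h
    · subst h
      rw [mul_one, hd]
      congr 1
      ext v
      change (α a).symm (hD.proj a (α a v : M)) = v
      rw [hD.proj_self]
      exact (α a).symm_apply_apply v
    · have : (p a).comp (q a') = 0 := by
        ext v
        change (α a).symm (hD.proj a (α a' v : M)) = 0
        rw [hD.proj_of_ne fun h' => h (Subtype.ext h'.symm)]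
        exact map_zero (α a).symm
      rw [this, map_zero, mul_zero]
  have hrank : (P * Q).rank = A.card := by
    rw [hPQ, Matrix.rank_of_isUnit _ ?_, Fintype.card_coe]
    rw [Matrix.isUnit_iff_isUnit_det, Matrix.det_smul, Matrix.det_one, mul_one]
    exact (pow_ne_zero _ (mul_ne_zero hd0 hd0)).isUnit
  calc A.card = (P * Q).rank := hrank.symm
    _ ≤ P.rank := Matrix.rank_mul_le_left P Q
    _ ≤ Fintype.card B := P.rank_le_card_width
    _ = B.card := Fintype.card_coe B

/-- Indecomposable objects occur with the same multiplicity in all decompositions. -/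
theorem nonempty_equiv_of_iso [CharZero K] (hX : InExtendedO 𝔥 𝔟 X)
    (hind : IsIndecomposableModule K 𝔤 X) (hM : InExtendedO 𝔥 𝔟 M)
    (hD : IsIndecomposableDecomposition 𝔥 𝔟 D) (hD' : IsIndecomposableDecomposition 𝔥 𝔟 D') :
    Nonempty ({j // Nonempty (X ≃ₗ⁅K,𝔤⁆ D j)} ≃ {j // Nonempty (X ≃ₗ⁅K,𝔤⁆ D' j)}) := by
  have := hind.nonzero
  obtain ⟨μ, hμ⟩ : ∃ μ : Module.Dual K 𝔥, weightSpaceOf 𝔥 X μ ≠ ⊥ := by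
    by_contra! h
    have := hX.span
    simp only [h, iSup_bot] at this
    exact bot_ne_top this
  obtain ⟨A, hA, hAsum⟩ := exists_finset_weightTrace_eq_sum hX hind hM hD hμ
  obtain ⟨B, hB, hBsum⟩ := exists_finset_weightTrace_eq_sum hX hind hM hD' hμ
  have hcard : A.card = B.card := le_antisymm
    (card_le_card_of_iso hX hind hD hD' (fun j => (hA j).mp) (fun j => (hB j).mp) hμ hBsum)
    (card_le_card_of_iso hX hind hD' hD (fun j => (hB j).mp) (fun j => (hA j).mp) hμ hAsum)
  exact ⟨(Equiv.subtypeEquivRight fun j => (hA j).symm).trans <|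
    (Finset.equivOfCardEq hcard).trans (Equiv.subtypeEquivRight hB)⟩

/-- Every D' j' is isomorphic to some D (c j'), since its multiplicity in `D` equals that in `D'`,
which is not zero. Both index sets thus map to the isomorphism classes of the `D j`; the fibres are
equinumerous, and bijections between them glue. -/
theorem exists_equiv_of_decompositions [CharZero K] (hM : InExtendedO 𝔥 𝔟 M)
    (hD : IsIndecomposableDecomposition 𝔥 𝔟 D) (hD' : IsIndecomposableDecomposition 𝔥 𝔟 D') :
    ∃ ψ : J ≃ J', ∀ j, Nonempty (D j ≃ₗ⁅K,𝔤⁆ D' (ψ j)) := by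
  let r : Setoid J :=
    { r := fun i j => Nonempty (D i ≃ₗ⁅K,𝔤⁆ D j)
      iseqv := ⟨fun _ => ⟨LieModuleEquiv.refl⟩, fun ⟨e⟩ => ⟨e.symm⟩,
        fun ⟨e⟩ ⟨f⟩ => ⟨e.trans f⟩⟩ }
  have hex (j' : J') : ∃ j, Nonempty (D' j' ≃ₗ⁅K,𝔤⁆ D j) := by
    obtain ⟨e⟩ := nonempty_equiv_of_iso (hD'.mem j') (hD'.indecomposable j') hM hD' hD
    exact ⟨_, (e ⟨j', ⟨LieModuleEquiv.refl⟩⟩).2⟩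
  choose c hc using hex
  have hfib (x : Quotient r) : Nonempty
      ({j // Quotient.mk r j = x} ≃ {j' // Quotient.mk r (c j') = x}) := by
    induction x using Quotient.inductionOn with | _ j₀ =>
    obtain ⟨e⟩ := nonempty_equiv_of_iso (hD.mem j₀) (hD.indecomposable j₀) hM hD hD'
    refine ⟨(Equiv.subtypeEquivRight fun j => ?_).trans
      (e.trans (Equiv.subtypeEquivRight fun j' => ?_))⟩
    · rw [Quotient.eq]
      exact ⟨fun ⟨f⟩ => ⟨f.symm⟩, fun ⟨f⟩ => ⟨f.symm⟩⟩
    · rw [Quotient.eq]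
      obtain ⟨g⟩ := hc j'
      exact ⟨fun ⟨f⟩ => ⟨(f.trans g).symm⟩, fun ⟨f⟩ => ⟨(g.trans f).symm⟩⟩
  refine ⟨Equiv.ofFiberEquiv fun x => (hfib x).some, fun j => ?_⟩
  have h := Equiv.ofFiberEquiv_map (fun x => (hfib x).some) j
  obtain ⟨f⟩ := Quotient.eq.mp h
  obtain ⟨g⟩ := hc (Equiv.ofFiberEquiv (fun x => (hfib x).some) j)
  exact ⟨(g.trans f).symm⟩

end KrullSchmidt

end ExtO

theorem mainTheorem7 {K : Type u} [Field K] [IsAlgClosed K] [CharZero K]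
    {𝔤 : Type v} [LieRing 𝔤] [LieAlgebra K 𝔤] (h𝔤 : ExtO.IsRootReductive K 𝔤)
    (𝔥 𝔟 : LieSubalgebra K 𝔤) (h𝔟 : ExtO.IsDynkinBorel 𝔥 𝔟)
    (M : Type w) [AddCommGroup M] [Module K M] [LieRingModule 𝔤 M] [LieModule K 𝔤 M]
    (hM : ExtO.InExtendedO 𝔥 𝔟 M) :
    -- existence of a decomposition into indecomposable objects
    (∃ (J : Type w) (D : J → LieSubmodule K 𝔤 M), ExtO.IsIndecomposableDecomposition 𝔥 𝔟 D) ∧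
    -- uniqueness up to isomorphism
    (∀ (J : Type w₁) (J' : Type w₂) (D : J → LieSubmodule K 𝔤 M) (D' : J' → LieSubmodule K 𝔤 M),
      ExtO.IsIndecomposableDecomposition 𝔥 𝔟 D → ExtO.IsIndecomposableDecomposition 𝔥 𝔟 D' →
        ∃ ψ : J ≃ J', ∀ j, Nonempty (D j ≃ₗ⁅K,𝔤⁆ D' (ψ j))) ∧
    -- indecomposable objects have local endomorphism rings
    (ExtO.IsIndecomposableModule K 𝔤 M → IsLocalRing (ExtO.moduleEnd K 𝔤 M)) := by
  exact ⟨hM.exists_decomposition,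
    fun J J' D D' hD hD' => ExtO.exists_equiv_of_decompositions hM hD hD',
    fun hind => hM.isLocalRing hind⟩
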